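/- Let $X,X_1,\dots,X_n$ ($n\ge 1$) be random vectors in $\mathbb R^D$, where $X_1,\dots,X_n$ are independent and each has the distribution of $X$, with $\mathbb E\|X\|^4<\infty$, where $\|\cdot\|$ is the Euclidean norm. Put $\mu=\mathbb EX$ (not assumed to be $0$) and $\Sigma=\mathbb E\big[(X-\mu)(X-\mu)^T\big]$, and let $\lambda_1\ge\lambda_2\ge\dots\ge\lambda_D\ge 0$ be the eigenvalues of $\Sigma$, counted with multiplicity; put $\lambda_{D+1}:=0$. For $0<p<\alpha<\frac12$ let $$\psi(\alpha;p)=(1-\alpha)\log\frac{1-\alpha}{1-p}+\alpha\log\frac{\alpha}{p}.$$ Let $0<\delta<1$ and $k=\Big\lfloor \frac{\log(1/\delta)}{\psi(7/18;\,0.1)}\Big\rfloor+1$. Let $G_1,\dots,G_k$ be disjoint subsets of $\{1,\dots,n\}$, each of size $\lfloor n/k\rfloor$, and for $1\le j\le k$ set $$\hat\mu_j=\frac1{|G_j|}\sum_{i\in G_j}X_i,\qquad \hat\Sigma_j=\frac1{|G_j|}\sum_{i\in G_j}(X_i-\hat\mu_j)(X_i-\hat\mu_j)^T$$ (with value $0$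 if $G_j=\emptyset$, a case that the assumption on $\Delta_m$ below rules out). Let $\hat\Sigma$ be a geometric median of $\hat\Sigma_1,\dots,\hat\Sigma_k$ in the Frobenius norm $\|A\|_{\rm F}=\sqrt{\operatorname{tr}(A^TA)}$, that is, any minimizer of $A\mapsto\sum_{j=1}^k\|A-\hat\Sigma_j\|_{\rm F}$ over $\mathbb R^{D\times D}$. Let $1\le m\le D$ and $\Delta_m=\lambda_m-\lambda_{m+1}$. Let $\mathrm{Proj}_m$ be the orthogonal projector onto the span of orthonormal eigenvectors of $\Sigma$ belonging to its $m$ largest eigenvalues $\lambda_1,\dots,\lambda_m$, and let $\widehat{\mathrm{Proj}}_m$ be the orthogonal projector onto the span of orthonormal eigenvectors of $\hat\Sigma$ belonging to its $m$ largest eigenvalues, counted with multiplicity (any choice, if there is a tie). Let $$\varepsilon_n(\delta)=15.2\sqrt{\frac{\big(\mathbb E\|X-\mu\|^4-\operatorname{tr}(\Sigma^2)\big)\log(1.4/\delta)}{n}}+178\,\frac{\operatorname{tr}(\Sigma)\log(1.4/\delta)}{n}$$ and assume that $\Delta_m>4\varepsilon_n(\delta)$. Then $$\Pr\left(\big\|\widehat{\mathrm{Proj}}_m-\mathrm{Proj}_m\big\|_{\rm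 F}\ge\frac{2\varepsilon_n(\delta)}{\Delta_m}\right)\le\delta .$$ -/

import Mathlib

open MeasureTheory ProbabilityTheory

namespace RobustPCA

noncomputable section

/-- `ψ(α; p) = (1 - α) log ((1 - α) / (1 - p)) + α log (α / p)`. -/
def psi (α p : ℝ) : ℝ :=
  (1 - α) * Real.log ((1 - α) / (1 - p)) + α * Real.log (α / p)

/-- The number of groups `k = ⌊log (1 / δ) / ψ(7/18; 0.1)⌋ + 1`. -/
def numBlocks (δ : ℝ) : ℕ :=
  ⌊Real.log (1 / δ) / psi (7 / 18) 0.1⌋₊ + 1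

/-- The Frobenius norm `‖A‖_F = √(tr (Aᵀ A))`. -/
def frobNorm {D : ℕ} (A : Matrix (Fin D) (Fin D) ℝ) : ℝ :=
  Real.sqrt (Matrix.trace (A.transpose * A))

/-- `y` is a geometric median of the finite family `x` with respect to the norm `N`: it
minimizes `z ↦ ∑ j, N (z - x j)` over the whole space. -/
def IsGeometricMedian {V ι : Type*} [Sub V] [Fintype ι] (N : V → ℝ) (x : ι → V) (y : V) : Prop :=
  ∀ z : V, ∑ j, N (y - x j) ≤ ∑ j, N (z - x j)

/-- The rank-one matrix `v vᵀ`. -/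
def outer {D : ℕ} (v : EuclideanSpace ℝ (Fin D)) : Matrix (Fin D) (Fin D) ℝ :=
  Matrix.of fun a b => v a * v b

/-- The sample mean of the observations with indices in `G`. -/
def blockMean {n D : ℕ} (x : Fin n → EuclideanSpace ℝ (Fin D)) (G : Finset (Fin n)) :
    EuclideanSpace ℝ (Fin D) :=
  (G.card : ℝ)⁻¹ • ∑ i ∈ G, x i

/-- The (empirically centered) sample covariance matrix of the observations with indices
in `G`. -/
def blockCov {n D : ℕ} (x : Fin n → EuclideanSpace ℝ (Fin D)) (G : Finset (Fin n)) :
    Matrix (Fin D) (Fin D) ℝ :=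
  (G.card : ℝ)⁻¹ • ∑ i ∈ G, outer (x i - blockMean x G)

/-- The mean `𝔼 X`. -/
def mean {Ω : Type*} [MeasurableSpace Ω] {D : ℕ} (P : Measure Ω)
    (X : Ω → EuclideanSpace ℝ (Fin D)) : EuclideanSpace ℝ (Fin D) :=
  ∫ ω, X ω ∂P

/-- The covariance matrix `𝔼 (X - 𝔼 X)(X - 𝔼 X)ᵀ`, the expectation being taken entrywise. -/
def covMatrix {Ω : Type*} [MeasurableSpace Ω] {D : ℕ} (P : Measure Ω)
    (X : Ω → EuclideanSpace ℝ (Fin D)) : Matrix (Fin D) (Fin D) ℝ :=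
  Matrix.of fun a b => ∫ ω, outer (X ω - mean P X) a b ∂P

/-- `b` is an orthonormal basis of eigenvectors of `A`, the `i`-th one belonging to the eigenvalue
`l i`, and the eigenvalues (repeated according to multiplicity) are listed in decreasing order. -/
structure IsSortedEigenbasis {D : ℕ} (A : Matrix (Fin D) (Fin D) ℝ)
    (b : OrthonormalBasis (Fin D) ℝ (EuclideanSpace ℝ (Fin D))) (l : Fin D → ℝ) : Prop where
  antitone : Antitone l
  eigen : ∀ i, Matrix.toEuclideanLin A (b i) = l i • b i

/-- The orthogonal projector `∑_{i ≤ m} b_i b_iᵀ` onto the span of the first `m` vectors of the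
orthonormal basis `b`. -/
def topProj {D : ℕ} (b : OrthonormalBasis (Fin D) ℝ (EuclideanSpace ℝ (Fin D))) (m : ℕ) :
    Matrix (Fin D) (Fin D) ℝ :=
  ∑ i : Fin D with i.val < m, outer (b i)

/-- The `i`-th term, counted from `1`, of the list of eigenvalues `l`, extended by `0` beyond the
dimension. -/
def eigenvalueAt {D : ℕ} (l : Fin D → ℝ) (i : ℕ) : ℝ :=
  if h : i - 1 < D then l ⟨i - 1, h⟩ else 0

/-- The spectral gap `Δ_m = λ_m - λ_{m+1}`. -/
def eigenGap {D : ℕ} (l : Fin D → ℝ) (m : ℕ) : ℝ :=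
  eigenvalueAt l m - eigenvalueAt l (m + 1)

/-- The error level
`ε_n(δ) = 15.2 √((𝔼‖X - μ‖⁴ - tr Σ²) log(1.4/δ) / n) + 178 tr(Σ) log(1.4/δ) / n`. -/
def errorLevel {Ω : Type*} [MeasurableSpace Ω] {D : ℕ} (P : Measure Ω)
    (X : Ω → EuclideanSpace ℝ (Fin D)) (n : ℕ) (δ : ℝ) : ℝ :=
  15.2 * Real.sqrt (((∫ ω, ‖X ω - mean P X‖ ^ 4 ∂P)
      - Matrix.trace (covMatrix P X * covMatrix P X)) * Real.log (1.4 / δ) / n)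
    + 178 * (Matrix.trace (covMatrix P X) * Real.log (1.4 / δ) / n)

end

end RobustPCA

/-! Each block covariance is accurate only with constant probability; the geometric median turns
this into exponentially small failure probability.

Single block: about the true mean, the block covariance minus `Σ` is an average of independent
centered matrices minus the rank-one matrix of the centered block mean. Their second moments are
explicit, and Markov's inequality bounds the error by a radius `r` outside an event of probability
at most `1/10` (`measureReal_lt_norm_vec_blockCov_sub_le`).

Median: if it lies at distance at least `(11/√72) r` from `Σ`, then at least `7/18` of the blocks
lie farther than `r` from `Σ`; otherwise a small step towards `Σ` would lower the objective
(`IsGeometricMedian.card_le_card_filter`). Disjoint blocks are independent, so Chernoff gives this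
probability at most `exp (-k ψ) ≤ δ` (`measure_card_ge_le`).

Projectors: `Q ↦ ⟨Σ, Q⟩` is curved at its maximizer `Proj_m`, with curvature set by the gap, so a
Frobenius error below `ε` moves the maximizer by less than `2ε/Δ_m`
(`IsSortedEigenbasis.gap_mul_frobNorm_le`). -/

namespace RobustPCA

/-! ### Matrices with the Frobenius inner product -/

/-- A square matrix regarded as a vector of the Euclidean space of its entries. -/
noncomputable def vec {D : ℕ} (A : Matrix (Fin D) (Fin D) ℝ) : EuclideanSpace ℝ (Fin D × Fin D) :=
  WithLp.toLp 2 fun p => A p.1 p.2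

@[simp] lemma vec_apply {D : ℕ} (A : Matrix (Fin D) (Fin D) ℝ) (p : Fin D × Fin D) :
    vec A p = A p.1 p.2 := rfl

lemma vec_sub {D : ℕ} (A B : Matrix (Fin D) (Fin D) ℝ) : vec (A - B) = vec A - vec B := rfl

lemma vec_smul {D : ℕ} (c : ℝ) (A : Matrix (Fin D) (Fin D) ℝ) : vec (c • A) = c • vec A := rfl

lemma vec_sum {D : ℕ} {ι : Type*} (s : Finset ι) (A : ι → Matrix (Fin D) (Fin D) ℝ) :
    vec (∑ i ∈ s, A i) = ∑ i ∈ s, vec (A i) := by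
  ext p
  simp [Matrix.sum_apply]

lemma inner_vec {D : ℕ} (A B : Matrix (Fin D) (Fin D) ℝ) :
    inner ℝ (vec A) (vec B) = ∑ i, ∑ j, A i j * B i j := by
  simp [PiLp.inner_apply, Fintype.sum_prod_type, mul_comm]

lemma frobNorm_eq_norm_vec {D : ℕ} (A : Matrix (Fin D) (Fin D) ℝ) : frobNorm A = ‖vec A‖ := by
  rw [EuclideanSpace.norm_eq, frobNorm]
  congr 1
  rw [Fintype.sum_prod_type, Finset.sum_comm]
  simp [Matrix.trace, Matrix.mul_apply, pow_two]

lemma inner_vec_outer {D : ℕ} (A : Matrix (Fin D) (Fin D) ℝ) (v : EuclideanSpace ℝ (Fin D)) :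
    inner ℝ (vec A) (vec (outer v)) = inner ℝ v (Matrix.toEuclideanLin A v) := by
  rw [inner_vec]
  simp only [outer, Matrix.of_apply, PiLp.inner_apply, Matrix.toLpLin_apply, Matrix.mulVec,
    dotProduct, RCLike.inner_apply, conj_trivial, Finset.sum_mul]
  refine Finset.sum_congr rfl fun i _ => Finset.sum_congr rfl fun j _ => ?_
  ring

lemma inner_vec_outer_outer {D : ℕ} (u v : EuclideanSpace ℝ (Fin D)) :
    inner ℝ (vec (outer u)) (vec (outer v)) = inner ℝ u v ^ 2 := by
  rw [inner_vec, pow_two, PiLp.inner_apply, Finset.sum_mul_sum]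
  refine Finset.sum_congr rfl fun i _ => Finset.sum_congr rfl fun j _ => ?_
  simp [outer]
  ring

lemma norm_vec_outer {D : ℕ} (v : EuclideanSpace ℝ (Fin D)) : ‖vec (outer v)‖ = ‖v‖ ^ 2 := by
  have h := inner_vec_outer_outer v v
  rw [real_inner_self_eq_norm_sq, real_inner_self_eq_norm_sq] at h
  exact (pow_left_inj₀ (norm_nonneg _) (by positivity) two_ne_zero).1 h

/-! ### Spectral projectors and the gap -/

section Eigen

variable {D : ℕ} {A : Matrix (Fin D) (Fin D) ℝ}
  {b : OrthonormalBasis (Fin D) ℝ (EuclideanSpace ℝ (Fin D))} {l : Fin D → ℝ}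

lemma IsSortedEigenbasis.inner_apply_self (h : IsSortedEigenbasis A b l)
    (v : EuclideanSpace ℝ (Fin D)) :
    inner ℝ v (Matrix.toEuclideanLin A v) = ∑ i, l i * inner ℝ (b i) v ^ 2 := by
  conv_lhs => rw [← b.sum_repr' v]
  simp only [map_sum, map_smul, h.eigen, sum_inner, inner_sum, real_inner_smul_left,
    real_inner_smul_right, b.inner_eq_ite]
  refine Finset.sum_congr rfl fun i _ => ?_
  simp
  ring

lemma IsSortedEigenbasis.inner_eigenvector (h : IsSortedEigenbasis A b l) (i : Fin D) :
    inner ℝ (b i) (Matrix.toEuclideanLin A (b i)) = l i := by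
  rw [h.eigen, real_inner_smul_right, real_inner_self_eq_norm_sq]
  simp

lemma sum_inner_sq_left (b : OrthonormalBasis (Fin D) ℝ (EuclideanSpace ℝ (Fin D)))
    (v : EuclideanSpace ℝ (Fin D)) : ∑ i, inner ℝ (b i) v ^ 2 = ‖v‖ ^ 2 := by
  simpa [Real.norm_eq_abs, sq_abs] using b.sum_sq_norm_inner_right v

lemma inner_topProj_topProj (b b' : OrthonormalBasis (Fin D) ℝ (EuclideanSpace ℝ (Fin D)))
    (m : ℕ) : inner ℝ (vec (topProj b m)) (vec (topProj b' m)) =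
      ∑ i : Fin D with i.val < m, ∑ j : Fin D with j.val < m, inner ℝ (b i) (b' j) ^ 2 := by
  simp only [topProj, vec_sum, sum_inner, inner_sum, inner_vec_outer_outer]
  exact Finset.sum_comm

lemma norm_sq_topProj (b : OrthonormalBasis (Fin D) ℝ (EuclideanSpace ℝ (Fin D))) (m : ℕ) :
    ‖vec (topProj b m)‖ ^ 2 = ((Finset.univ.filter fun i : Fin D => i.val < m).card : ℝ) := by
  rw [← real_inner_self_eq_norm_sq, inner_topProj_topProj, Finset.card_eq_sum_ones, Nat.cast_sum]
  refine Finset.sum_congr rfl fun i hi => ?_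
  simp only [b.inner_eq_ite, ite_pow, one_pow, ne_eq, OfNat.ofNat_ne_zero, not_false_eq_true,
    zero_pow, Finset.sum_ite_eq, hi, if_true, Nat.cast_one]

/-- The curvature of `Q ↦ ⟨A, Q⟩` at the projector onto the leading eigenvectors: replacing it by
another projector of the same rank loses at least half the gap times the squared distance. -/
lemma IsSortedEigenbasis.gap_mul_norm_sq_le (h : IsSortedEigenbasis A b l)
    (b' : OrthonormalBasis (Fin D) ℝ (EuclideanSpace ℝ (Fin D))) (m : ℕ) {a c : ℝ}
    (ha : ∀ i : Fin D, i.val < m → a ≤ l i) (hc : ∀ i : Fin D, ¬ i.val < m → l i ≤ c) :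
    (a - c) / 2 * ‖vec (topProj b m) - vec (topProj b' m)‖ ^ 2
      ≤ inner ℝ (vec A) (vec (topProj b m) - vec (topProj b' m)) := by
  classical
  -- `q i` is the squared length of the projection of `b i` onto the span of the leading `b'`: a
  -- weight in `[0, 1]` of total mass `M`, the common rank.
  set q : Fin D → ℝ := fun i => ∑ j : Fin D with j.val < m, inner ℝ (b i) (b' j) ^ 2 with hq
  set M : ℝ := ((Finset.univ.filter fun i : Fin D => i.val < m).card : ℝ) with hM
  have hq0 : ∀ i, 0 ≤ q i := fun i => Finset.sum_nonneg fun j _ => sq_nonneg _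
  have hq1 : ∀ i, q i ≤ 1 := fun i => by
    have h1 : q i ≤ ∑ j, inner ℝ (b i) (b' j) ^ 2 :=
      Finset.sum_le_sum_of_subset_of_nonneg (Finset.filter_subset _ _) fun j _ _ => sq_nonneg _
    have h2 := sum_inner_sq_left b' (b i)
    rw [OrthonormalBasis.norm_eq_one, one_pow] at h2
    refine h1.trans (le_of_eq ?_)
    rw [← h2]
    exact Finset.sum_congr rfl fun j _ => by rw [real_inner_comm]
  have hqs : ∑ i, q i = M := by
    rw [hq, Finset.sum_comm, hM, Finset.card_eq_sum_ones, Nat.cast_sum]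
    refine Finset.sum_congr rfl fun j _ => ?_
    rw [sum_inner_sq_left]
    simp
  have hsplit := Finset.sum_filter_add_sum_filter_not Finset.univ (fun i : Fin D => i.val < m) q
  have hAP : inner ℝ (vec A) (vec (topProj b m)) = ∑ i : Fin D with i.val < m, l i := by
    simp only [topProj, vec_sum, inner_sum, inner_vec_outer, h.inner_eigenvector]
  have hAP' : inner ℝ (vec A) (vec (topProj b' m)) = ∑ i, l i * q i := by
    simp only [topProj, vec_sum, inner_sum, inner_vec_outer, h.inner_apply_self, hq,
      Finset.mul_sum]
    exact Finset.sum_comm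
  have hsplit' := Finset.sum_filter_add_sum_filter_not Finset.univ (fun i : Fin D => i.val < m)
    fun i => l i * q i
  have hnorm : ‖vec (topProj b m) - vec (topProj b' m)‖ ^ 2
      = 2 * (M - ∑ i : Fin D with i.val < m, q i) := by
    rw [norm_sub_sq_real, norm_sq_topProj, norm_sq_topProj, inner_topProj_topProj]
    ring
  have h1 : a * (M - ∑ i : Fin D with i.val < m, q i)
      ≤ ∑ i : Fin D with i.val < m, l i - ∑ i : Fin D with i.val < m, l i * q i := by
    rw [hM, Finset.card_eq_sum_ones, Nat.cast_sum, ← Finset.sum_sub_distrib, Finset.mul_sum,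
      ← Finset.sum_sub_distrib]
    refine Finset.sum_le_sum fun i hi => ?_
    have := mul_le_mul_of_nonneg_right (ha i (Finset.mem_filter.1 hi).2) (sub_nonneg.2 (hq1 i))
    push_cast
    linarith
  have h2 : ∑ i : Fin D with ¬ i.val < m, l i * q i ≤ c * ∑ i : Fin D with ¬ i.val < m, q i := by
    rw [Finset.mul_sum]
    exact Finset.sum_le_sum fun i hi =>
      mul_le_mul_of_nonneg_right (hc i (Finset.mem_filter.1 hi).2) (hq0 i)
  have h3 : ∑ i : Fin D with ¬ i.val < m, q i = M - ∑ i : Fin D with i.val < m, q i := by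
    linarith
  rw [h3] at h2
  rw [inner_sub_right, hAP, hAP', hnorm, ← hsplit']
  linarith

lemma IsSortedEigenbasis.eigenvalueAt_le (h : IsSortedEigenbasis A b l) {m : ℕ} (hm1 : 1 ≤ m)
    (hmD : m ≤ D) (i : Fin D) (hi : i.val < m) : eigenvalueAt l m ≤ l i := by
  rw [eigenvalueAt, dif_pos (by omega)]
  exact h.antitone (Fin.le_def.2 (by simp; omega))

lemma IsSortedEigenbasis.le_eigenvalueAt (h : IsSortedEigenbasis A b l) {m : ℕ}
    (i : Fin D) (hi : ¬ i.val < m) : l i ≤ eigenvalueAt l (m + 1) := by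
  have := i.isLt
  rw [eigenvalueAt, dif_pos (by omega)]
  exact h.antitone (Fin.le_def.2 (by simp; omega))

/-- A form of the Davis-Kahan theorem in which only the unperturbed matrix has a gap. -/
lemma IsSortedEigenbasis.gap_mul_frobNorm_le (h : IsSortedEigenbasis A b l)
    {A' : Matrix (Fin D) (Fin D) ℝ} {b' : OrthonormalBasis (Fin D) ℝ (EuclideanSpace ℝ (Fin D))}
    {l' : Fin D → ℝ} (h' : IsSortedEigenbasis A' b' l') {m : ℕ} (hm1 : 1 ≤ m) (hmD : m ≤ D) :
    eigenGap l m * frobNorm (topProj b' m - topProj b m) ≤ 2 * frobNorm (A' - A) := by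
  have h1 := h.gap_mul_norm_sq_le b' m (h.eigenvalueAt_le hm1 hmD) (fun i => h.le_eigenvalueAt i)
  -- For `A'` only the maximality of its own projector is needed, so both thresholds are its `m`-th
  -- eigenvalue. The convention of a zero eigenvalue beyond `D` would not do at `m = D`, where that
  -- eigenvalue of `A'` could be negative.
  have h2 := h'.gap_mul_norm_sq_le b m (h'.eigenvalueAt_le hm1 hmD) (c := eigenvalueAt l' m)
    (fun i hi => by
      rw [eigenvalueAt, dif_pos (by omega)]
      exact h'.antitone (Fin.le_def.2 (by simp; omega)))
  rw [sub_self, zero_div, zero_mul] at h2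
  rw [frobNorm_eq_norm_vec, frobNorm_eq_norm_vec, vec_sub, vec_sub, eigenGap]
  rw [norm_sub_rev] at h1
  set u := vec (topProj b' m) - vec (topProj b m) with hu
  have hu' : vec (topProj b m) - vec (topProj b' m) = -u := by rw [hu, neg_sub]
  rw [hu', inner_neg_right] at h1
  have h3 : inner ℝ (vec A') u - inner ℝ (vec A) u ≤ ‖vec A' - vec A‖ * ‖u‖ := by
    rw [← inner_sub_left]
    exact real_inner_le_norm _ _
  rcases (norm_nonneg u).eq_or_lt with h0 | h0
  · rw [← h0, mul_zero]
    positivity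
  · refine le_of_mul_le_mul_right ?_ h0
    nlinarith

end Eigen

/-! ### Robustness of the geometric median -/

/-- A geometric median in an inner product space is robust: if it is far from `z`, then so are a
positive fraction of the points. -/
lemma IsGeometricMedian.card_le_card_filter {E ι : Type*} [NormedAddCommGroup E]
    [InnerProductSpace ℝ E] [Fintype ι] {x : ι → E} {y z : E} {r : ℝ}
    (h : IsGeometricMedian (fun v : E => ‖v‖) x y) (hr : 0 < r)
    (hyz : 121 * r ^ 2 ≤ 72 * ‖y - z‖ ^ 2) :
    7 / 18 * (Fintype.card ι : ℝ) ≤ ((Finset.univ.filter fun j => r < ‖x j - z‖).card : ℝ) := by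
  classical
  by_contra! hlt
  set d := z - y with hd
  have hyd : ‖y - z‖ = ‖d‖ := norm_sub_rev y z
  rw [hyd] at hyz
  have hrd : r < ‖d‖ := lt_of_pow_lt_pow_left₀ 2 (norm_nonneg _) (by nlinarith [sq_nonneg ‖d‖])
  have hd0 : 0 < ‖d‖ := hr.trans hrd
  set B : ℝ := ((Finset.univ.filter fun j => r < ‖x j - z‖).card : ℝ) with hB
  set H : ℝ := ((Finset.univ.filter fun j => ¬ r < ‖x j - z‖).card : ℝ) with hH
  have hBH : B + H = Fintype.card ι := by
    rw [hB, hH, ← Nat.cast_add, Finset.card_filter_add_card_filter_not, Finset.card_univ]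
  have hbad : ∀ t : ℝ, 0 ≤ t → ∀ j, ‖y + t • d - x j‖ - ‖y - x j‖ ≤ t * ‖d‖ := fun t ht j => by
    have : y + t • d - x j = (y - x j) + t • d := by abel
    rw [this]
    have := norm_add_le (y - x j) (t • d)
    rw [norm_smul, Real.norm_of_nonneg ht] at this
    linarith
  -- From `y`, a point near `z` is seen at an angle to `d` with cosine at least `7/11 = α/(1-α)`, `α
  -- = 7/18`; the constant `121/72` is `1/(1-(7/11)²)`. The bound `‖u‖ ≥ ‖d‖ - r` makes the
  -- quadratic error uniform over these points.
  have hgood : ∀ t : ℝ, 0 ≤ t → ∀ j, ¬ r < ‖x j - z‖ → ‖y + t • d - x j‖ - ‖y - x j‖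
      ≤ - (7 / 11) * t * ‖d‖ + t ^ 2 * (‖d‖ ^ 2 / (2 * (‖d‖ - r))) := fun t ht j hj => by
    push Not at hj
    set u := x j - y with hu
    have hud : x j - z = u - d := by rw [hu, hd]; abel
    rw [hud] at hj
    have hus : ‖d‖ - r ≤ ‖u‖ := by
      have := norm_sub_norm_le d u
      rw [norm_sub_rev u d] at hj
      linarith
    have hu0 : 0 < ‖u‖ := by linarith
    have hin : 7 / 11 * (‖u‖ * ‖d‖) ≤ inner ℝ u d := by
      have h1 : ‖u - d‖ ^ 2 ≤ r ^ 2 := pow_le_pow_left₀ (norm_nonneg _) hj 2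
      rw [norm_sub_sq_real] at h1
      nlinarith [sq_nonneg (‖u‖ - 7 / 11 * ‖d‖)]
    have e1 : ‖y - x j‖ = ‖u‖ := norm_sub_rev _ _
    have e2 : ‖y + t • d - x j‖ = ‖u - t • d‖ := by
      rw [← norm_neg, hu]; congr 1; abel
    rw [e1, e2]
    have h2 : ‖u - t • d‖ ^ 2 = ‖u‖ ^ 2 - 2 * (t * inner ℝ u d) + t ^ 2 * ‖d‖ ^ 2 := by
      rw [norm_sub_sq_real, real_inner_smul_right, norm_smul, mul_pow, Real.norm_eq_abs, sq_abs]
    -- `2a(b - a) ≤ b² - a²` linearizes the norm.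
    have h3 : 2 * ‖u‖ * (‖u - t • d‖ - ‖u‖) ≤ - 2 * (t * inner ℝ u d) + t ^ 2 * ‖d‖ ^ 2 := by
      nlinarith [sq_nonneg (‖u - t • d‖ - ‖u‖)]
    have h4 : 2 * ‖u‖ * (‖u - t • d‖ - ‖u‖)
        ≤ 2 * ‖u‖ * (- (7 / 11) * t * ‖d‖ + t ^ 2 * (‖d‖ ^ 2 / (2 * ‖u‖))) := by
      have : 2 * ‖u‖ * (- (7 / 11) * t * ‖d‖ + t ^ 2 * (‖d‖ ^ 2 / (2 * ‖u‖)))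
          = - 2 * (t * (7 / 11 * (‖u‖ * ‖d‖))) + t ^ 2 * ‖d‖ ^ 2 := by
        field_simp
      rw [this]
      have := mul_le_mul_of_nonneg_left hin ht
      linarith
    have h5 := le_of_mul_le_mul_left h4 (by positivity)
    have h6 : ‖d‖ ^ 2 / (2 * ‖u‖) ≤ ‖d‖ ^ 2 / (2 * (‖d‖ - r)) :=
      div_le_div_of_nonneg_left (by positivity) (by linarith) (by linarith)
    have := mul_le_mul_of_nonneg_left h6 (sq_nonneg t)
    linarith
  set K : ℝ := ‖d‖ ^ 2 / (2 * (‖d‖ - r)) with hK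
  have hK0 : 0 < K := div_pos (by positivity) (by linarith)
  have key : ∀ t : ℝ, 0 ≤ t →
      0 ≤ B * (t * ‖d‖) + H * (- (7 / 11) * t * ‖d‖ + t ^ 2 * K) := fun t ht => by
    have h1 : 0 ≤ ∑ j, (‖y + t • d - x j‖ - ‖y - x j‖) := by
      rw [Finset.sum_sub_distrib, sub_nonneg]
      exact h _
    rw [← Finset.sum_filter_add_sum_filter_not Finset.univ (fun j => r < ‖x j - z‖)] at h1
    have h2 := Finset.sum_le_card_nsmul (Finset.univ.filter fun j => r < ‖x j - z‖)
      (fun j => ‖y + t • d - x j‖ - ‖y - x j‖) _ fun j _ => hbad t ht j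
    have h3 := Finset.sum_le_card_nsmul (Finset.univ.filter fun j => ¬ r < ‖x j - z‖)
      (fun j => ‖y + t • d - x j‖ - ‖y - x j‖) _ fun j hj =>
        hgood t ht j (Finset.mem_filter.1 hj).2
    rw [nsmul_eq_mul] at h2 h3
    linarith
  have hB0 : 0 ≤ B := Nat.cast_nonneg _
  have hH0 : 0 < H := by linarith
  set s : ℝ := (7 / 11 * H - B) * ‖d‖ with hs
  have hs0 : 0 < s := mul_pos (by linarith) hd0
  -- The bound in `key` equals `-s t + H K t²`, and this `t` minimizes it. Here `s > 0`, because `B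
  -- < 7/18 (B + H)` means `B < 7/11 H`.
  have h1 := key (s / (2 * (H * K))) (by positivity)
  have h2 : B * (s / (2 * (H * K)) * ‖d‖) + H * (- (7 / 11) * (s / (2 * (H * K))) * ‖d‖
      + (s / (2 * (H * K))) ^ 2 * K) = - (s ^ 2 / (4 * (H * K))) := by
    have : B * (s / (2 * (H * K)) * ‖d‖) + H * (- (7 / 11) * (s / (2 * (H * K))) * ‖d‖
      + (s / (2 * (H * K))) ^ 2 * K)
      = - s * (s / (2 * (H * K))) + H * K * (s / (2 * (H * K))) ^ 2 := by
      rw [hs]; ring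
    rw [this]
    field_simp
    ring
  rw [h2] at h1
  have : 0 < s ^ 2 / (4 * (H * K)) := by positivity
  linarith

/-! ### Numerical bounds for `ψ` and the number of blocks -/

lemma psi_eq : psi (7 / 18) 0.1 = 11 / 18 * Real.log (55 / 81) + 7 / 18 * Real.log (35 / 9) := by
  rw [psi]
  norm_num

/-- Clearing the denominator 18 leaves the logarithm of a rational, which can be compared with
rational bounds. -/
lemma psi_mul_eq_log : 18 * psi (7 / 18) 0.1 = Real.log ((55 / 81) ^ 11 * (35 / 9) ^ 7) := by
  rw [psi_eq, Real.log_mul (by positivity) (by positivity), Real.log_pow, Real.log_pow]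
  push_cast
  ring

lemma lt_psi : 0.2914 < psi (7 / 18) 0.1 := by
  have h : (5.2452 : ℝ) < Real.log ((55 / 81) ^ 11 * (35 / 9) ^ 7) := by
    rw [Real.lt_log_iff_exp_lt (by positivity)]
    -- `5.2452 = 18 * 0.2914`; splitting off the integer part leaves a short Taylor expansion.
    have e : (5.2452 : ℝ) = 5 * 1 + 0.2452 := by norm_num
    rw [e, Real.exp_add, ← Nat.cast_ofNat (R := ℝ) (n := 5), Real.exp_nat_mul]
    have h1 : Real.exp 1 ^ 5 ≤ 2.7182818286 ^ 5 :=
      pow_le_pow_left₀ (Real.exp_pos _).le Real.exp_one_lt_d9.le 5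
    have h2 := Real.exp_bound' (x := 0.2452) (by norm_num) (by norm_num) (n := 5) (by norm_num)
    simp only [Finset.sum_range_succ, Finset.sum_range_zero, Nat.factorial] at h2
    have h3 : Real.exp 0.2452 ≤ 1.278 := h2.trans (by norm_num)
    calc Real.exp 1 ^ 5 * Real.exp 0.2452 ≤ 2.7182818286 ^ 5 * 1.278 :=
          mul_le_mul h1 h3 (Real.exp_pos _).le (by norm_num)
      _ < _ := by norm_num
  rw [← psi_mul_eq_log] at h
  linarith

/-- This absorbs the `+ 1` in the number of blocks: `k ψ ≤ log (1/δ) + ψ ≤ log (1.4/δ)`. -/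
lemma psi_lt : psi (7 / 18) 0.1 < Real.log 1.4 := by
  have h : Real.log ((55 / 81) ^ 11 * (35 / 9) ^ 7) < 18 * Real.log 1.4 := by
    rw [show (18 : ℝ) * Real.log 1.4 = Real.log (1.4 ^ 18) by rw [Real.log_pow]; norm_num]
    exact Real.log_lt_log (by positivity) (by norm_num)
  rw [← psi_mul_eq_log] at h
  linarith

lemma psi_pos : 0 < psi (7 / 18) 0.1 := lt_trans (by norm_num) lt_psi

lemma numBlocks_mul_psi_le {δ : ℝ} (hδ0 : 0 < δ) (hδ1 : δ < 1) :
    numBlocks δ * psi (7 / 18) 0.1 ≤ Real.log (1.4 / δ) := by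
  have h0 : 0 ≤ Real.log (1 / δ) := Real.log_nonneg (by rw [le_div_iff₀ hδ0]; linarith)
  have h1 := Nat.floor_le (div_nonneg h0 psi_pos.le)
  rw [le_div_iff₀ psi_pos] at h1
  rw [numBlocks, Nat.cast_add, Nat.cast_one, add_mul, one_mul]
  rw [Real.log_div (by norm_num) hδ0.ne', Real.log_one] at *
  linarith [psi_lt, Real.log_div (x := 1.4) (by norm_num) hδ0.ne']

lemma exp_neg_numBlocks_mul_psi_le {δ : ℝ} (hδ0 : 0 < δ) :
    Real.exp (-(numBlocks δ * psi (7 / 18) 0.1)) ≤ δ := by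
  rw [← Real.le_log_iff_exp_le hδ0]
  have h1 := (Nat.lt_floor_add_one (Real.log (1 / δ) / psi (7 / 18) 0.1)).le
  rw [div_le_iff₀ psi_pos, Real.log_div one_ne_zero hδ0.ne', Real.log_one] at h1
  rw [numBlocks, Nat.cast_add, Nat.cast_one, Real.log_div one_ne_zero hδ0.ne', Real.log_one]
  linarith

/-- With `α = 7/18` and `p = 1/10`, the optimal Chernoff tilt is `α(1-p)/(p(1-α)) = 63/11`, and the
tilted mean is `1 - p + 63p/11 = 81/55`. -/
lemma rpow_mul_eq_exp_neg_psi (k : ℕ) :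
    ((63 / 11 : ℝ) ^ (7 / 18 * (k : ℝ)))⁻¹ * (81 / 55) ^ k
      = Real.exp (-(k * psi (7 / 18) 0.1)) := by
  rw [← Real.exp_log (show (0 : ℝ) < (81 / 55) ^ k by positivity), Real.log_pow,
    Real.rpow_def_of_pos (by norm_num), ← Real.exp_neg, ← Real.exp_add, psi_eq]
  congr 1
  rw [show (63 / 11 : ℝ) = (35 / 9) * (55 / 81)⁻¹ by norm_num,
    show (81 / 55 : ℝ) = (55 / 81)⁻¹ by norm_num, Real.log_mul (by norm_num) (by norm_num),
    Real.log_inv]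
  ring

/-! ### Independent blocks and the Chernoff bound -/

section Independence

variable {Ω : Type*} [MeasurableSpace Ω] {P : Measure Ω} {ι κ E : Type*}

/-- Expectations of products of functions of disjoint groups of independent variables factor. -/
lemma integral_prod_eq_prod_integral_of_dependsOn [MeasurableSpace E] [Zero E]
    {Y : ι → Ω → E} (hY : ∀ i, AEMeasurable (Y i) P) (hind : iIndepFun Y P)
    {G : κ → Finset ι} (hG : ∀ j j', j ≠ j' → Disjoint (G j) (G j'))
    {f : κ → (ι → E) → ℝ} (hf : ∀ j, Measurable (f j))
    (hdep : ∀ j, DependsOn (f j) (G j : Set ι)) [Countable ι] (s : Finset κ) :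
    ∫ ω, ∏ j ∈ s, f j (fun i => Y i ω) ∂P = ∏ j ∈ s, ∫ ω, f j (fun i => Y i ω) ∂P := by
  classical
  have := hind.isProbabilityMeasure
  have hYm : AEMeasurable (fun ω i => Y i ω) P := aemeasurable_pi_iff.2 hY
  induction s using Finset.induction_on with
  | empty => simp
  | insert a s ha ih =>
    simp_rw [Finset.prod_insert ha]
    rw [← ih]
    set S := s.biUnion G with hS
    -- Extension by zero lets a function depending only on the coordinates in `T` be read as a
    -- function on `T → E`, to which independence of subfamilies applies.
    let ext (T : Finset ι) (x : T → E) (i : ι) : E := if h : i ∈ T then x ⟨i, h⟩ else 0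
    have hext : ∀ T, Measurable (ext T) := fun T => measurable_pi_iff.2 fun i => by
      by_cases h : i ∈ T
      · simpa only [ext, h, dif_pos] using measurable_pi_apply _
      · simp only [ext, h, dif_neg, not_false_eq_true, measurable_const]
    have hdisj : Disjoint (G a) S := by
      rw [hS, Finset.disjoint_biUnion_right]
      exact fun j hj => hG a j fun h => ha (h ▸ hj)
    have h1 := (hind.indepFun_finset₀ (G a) S hdisj hY).comp
      ((hf a).comp (hext _)) ((Finset.measurable_prod s fun j _ => hf j).comp (hext S))
    have e1 : (f a ∘ ext (G a)) ∘ (fun ω (i : G a) => Y i ω) = fun ω => f a fun i => Y i ω := by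
      ext ω
      refine hdep a fun i hi => ?_
      simp only [ext, Finset.mem_coe.1 hi, dif_pos]
    have e2 : ((fun x => ∏ j ∈ s, f j x) ∘ ext S) ∘ (fun ω (i : S) => Y i ω)
        = fun ω => ∏ j ∈ s, f j fun i => Y i ω := by
      ext ω
      refine Finset.prod_congr rfl fun j hj => hdep j fun i hi => ?_
      have : i ∈ S := Finset.mem_biUnion.2 ⟨j, hj, hi⟩
      simp only [ext, this, dif_pos]
    rw [e1, e2] at h1
    exact h1.integral_fun_mul_eq_mul_integral
      ((hf a).comp_aemeasurable hYm).aestronglyMeasurable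
      ((Finset.measurable_prod s fun j _ => hf j).comp_aemeasurable hYm).aestronglyMeasurable

/-- The Chernoff bound for the number of those among independent events of probability at most
`1 / 10` that occur. -/
lemma measure_card_ge_le [Countable ι] [Fintype κ] [MeasurableSpace E] [Zero E]
    {Y : ι → Ω → E} (hY : ∀ i, AEMeasurable (Y i) P) (hind : iIndepFun Y P)
    {G : κ → Finset ι} (hG : ∀ j j', j ≠ j' → Disjoint (G j) (G j'))
    {p : κ → (ι → E) → Prop} [∀ j, DecidablePred (p j)] (hp : ∀ j, MeasurableSet {x | p j x})
    (hdep : ∀ j, DependsOn (p j) (G j : Set ι))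
    (hprob : ∀ j, P.real {ω | p j fun i => Y i ω} ≤ 1 / 10) :
    P.real {ω | 7 / 18 * (Fintype.card κ : ℝ)
        ≤ ((Finset.univ.filter fun j => p j fun i => Y i ω).card : ℝ)}
      ≤ Real.exp (-(Fintype.card κ * psi (7 / 18) 0.1)) := by
  have := hind.isProbabilityMeasure
  have hYm : AEMeasurable (fun ω i => Y i ω) P := aemeasurable_pi_iff.2 hY
  set f : κ → (ι → E) → ℝ := fun j x => if p j x then 63 / 11 else 1 with hfdef
  have hf : ∀ j, Measurable (f j) := fun j =>
    Measurable.ite (hp j) measurable_const measurable_const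
  have hfdep : ∀ j, DependsOn (f j) (G j : Set ι) := fun j x y h => by
    simp only [hfdef, hdep j h]
  have hprod := integral_prod_eq_prod_integral_of_dependsOn hY hind hG hf hfdep Finset.univ
  have hint : ∀ j, ∫ ω, f j (fun i => Y i ω) ∂P ≤ 81 / 55 := fun j => by
    have hm : NullMeasurableSet {ω | p j fun i => Y i ω} P := hYm.nullMeasurableSet_preimage (hp j)
    have e : (fun ω => f j fun i => Y i ω)
        = fun ω => 1 + {ω | p j fun i => Y i ω}.indicator (fun _ => (52 / 11 : ℝ)) ω := by
      ext ω
      by_cases h : p j fun i => Y i ω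
      · simp [hfdef, h]; norm_num
      · simp [hfdef, h]
    rw [e, integral_add (integrable_const _) ((integrable_const _).indicator₀ hm),
      integral_indicator₀ hm]
    simp only [integral_const, smul_eq_mul, probReal_univ, measureReal_restrict_apply_univ]
    linarith [hprob j]
  have hpow : ∀ ω, ∏ j, f j (fun i => Y i ω)
      = (63 / 11) ^ (Finset.univ.filter fun j => p j fun i => Y i ω).card := fun ω => by
    simp only [hfdef, Finset.prod_ite, Finset.prod_const, one_pow, mul_one]
  have hle : ∏ j, ∫ ω, f j (fun i => Y i ω) ∂P ≤ (81 / 55) ^ Fintype.card κ := by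
    rw [← Finset.card_univ, ← Finset.prod_const]
    refine Finset.prod_le_prod (fun j _ => integral_nonneg fun ω => ?_) fun j _ => hint j
    simp only [hfdef, Pi.zero_apply]
    split_ifs <;> norm_num
  have hmeas : AEStronglyMeasurable (fun ω => ∏ j, f j (fun i => Y i ω)) P :=
    ((Finset.measurable_prod Finset.univ fun j _ => hf j).comp_aemeasurable
      hYm).aestronglyMeasurable
  have hinteg : Integrable (fun ω => ∏ j, f j (fun i => Y i ω)) P := by
    refine Integrable.of_bound hmeas ((63 / 11) ^ Fintype.card κ) (ae_of_all _ fun ω => ?_)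
    rw [hpow, Real.norm_of_nonneg (by positivity)]
    exact pow_le_pow_right₀ (by norm_num) (Finset.card_le_univ _)
  have hmarkov := mul_meas_ge_le_integral_of_nonneg
    (ae_of_all _ fun ω => by rw [hpow]; positivity) hinteg
    ((63 / 11 : ℝ) ^ (7 / 18 * (Fintype.card κ : ℝ)))
  rw [← rpow_mul_eq_exp_neg_psi, ← div_eq_inv_mul, le_div_iff₀' (by positivity)]
  refine le_trans ?_ (hmarkov.trans (hprod.le.trans hle))
  refine mul_le_mul_of_nonneg_left (measureReal_mono fun ω hω => ?_) (by positivity)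
  simp only [Set.mem_ofPred_eq] at hω ⊢
  rw [hpow, ← Real.rpow_natCast]
  exact Real.rpow_le_rpow_of_exponent_le (by norm_num) hω

end Independence

/-! ### Markov's inequality and second moments -/

section Moments

variable {Ω : Type*} [MeasurableSpace Ω] {P : Measure Ω} {ι κ : Type*}

/-- Markov's inequality, with strict inequality so that the expectation may vanish. -/
lemma measureReal_mul_integral_lt_le [IsProbabilityMeasure P] {Z : Ω → ℝ} (hZ : ∀ ω, 0 ≤ Z ω)
    (hint : Integrable Z P) {c : ℝ} (hc : 0 < c) {v : ℝ} (hv : ∫ ω, Z ω ∂P ≤ v) :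
    P.real {ω | c * v < Z ω} ≤ 1 / c := by
  have hI : 0 ≤ ∫ ω, Z ω ∂P := integral_nonneg hZ
  rcases (hI.trans hv).eq_or_lt with h0 | h0
  · have h1 : ∫ ω, Z ω ∂P = 0 := le_antisymm (by linarith) hI
    rw [integral_eq_zero_iff_of_nonneg hZ hint] at h1
    have h2 : P {ω | c * v < Z ω} = 0 := by
      refine measure_mono_null (fun ω hω => ?_) (ae_iff.1 h1)
      simp only [Set.mem_ofPred_eq, ← h0, mul_zero] at hω
      exact hω.ne'
    rw [measureReal_def, h2]
    simp [hc.le]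
  · have h1 := mul_meas_ge_le_integral_of_nonneg (ae_of_all _ hZ) hint (c * v)
    have h2 : P.real {ω | c * v < Z ω} ≤ P.real {ω | c * v ≤ Z ω} :=
      measureReal_mono fun ω (hω : c * v < Z ω) => hω.le
    rw [le_div_iff₀ hc]
    have h3 : v * (P.real {ω | c * v ≤ Z ω} * c) ≤ v * 1 := by linarith
    have := le_of_mul_le_mul_left h3 h0
    nlinarith

/-- The second moment of a sum of pairwise independent centered vectors. -/
lemma integral_norm_sq_sum_eq [IsProbabilityMeasure P] [Fintype κ] {Z : ι → Ω → EuclideanSpace ℝ κ}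
    (hZ : ∀ i, MemLp (Z i) 2 P) (h0 : ∀ i, ∫ ω, Z i ω ∂P = 0)
    (hind : Pairwise fun i j => IndepFun (Z i) (Z j) P) (s : Finset ι) :
    ∫ ω, ‖∑ i ∈ s, Z i ω‖ ^ 2 ∂P = ∑ i ∈ s, ∫ ω, ‖Z i ω‖ ^ 2 ∂P := by
  have hZa : ∀ i a, MemLp (fun ω => Z i ω a) 2 P := fun i a =>
    (EuclideanSpace.proj a : EuclideanSpace ℝ κ →L[ℝ] ℝ).comp_memLp' (hZ i)
  have h0a : ∀ i a, ∫ ω, Z i ω a ∂P = 0 := fun i a => by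
    have := (EuclideanSpace.proj a : EuclideanSpace ℝ κ →L[ℝ] ℝ).integral_comp_comm
      ((hZ i).integrable one_le_two)
    rw [h0 i, map_zero] at this
    exact this
  have hsum : ∀ a, MemLp (∑ i ∈ s, fun ω => Z i ω a) 2 P := fun a =>
    memLp_finsetSum' s fun i _ => hZa i a
  have hsum0 : ∀ a, ∫ ω, (∑ i ∈ s, fun ω => Z i ω a) ω ∂P = 0 := fun a => by
    simp only [Finset.sum_apply]
    rw [integral_finsetSum _ fun i _ => (hZa i a).integrable one_le_two]
    exact Finset.sum_eq_zero fun i _ => h0a i a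
  have hvar : ∀ a, ∫ ω, ((∑ i ∈ s, fun ω => Z i ω a) ω) ^ 2 ∂P
      = ∑ i ∈ s, ∫ ω, Z i ω a ^ 2 ∂P := fun a => by
    have h1 := IndepFun.variance_sum (μ := P) (s := s) (X := fun i ω => Z i ω a)
      (fun i _ => hZa i a) fun i _ j _ hij =>
        (hind hij).comp (EuclideanSpace.proj a : EuclideanSpace ℝ κ →L[ℝ] ℝ).measurable
          (EuclideanSpace.proj a : EuclideanSpace ℝ κ →L[ℝ] ℝ).measurable
    rw [variance_of_integral_eq_zero (hsum a).aestronglyMeasurable.aemeasurable (hsum0 a)] at h1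
    rw [h1]
    exact Finset.sum_congr rfl fun i _ =>
      variance_of_integral_eq_zero (hZa i a).aestronglyMeasurable.aemeasurable (h0a i a)
  have e : ∀ ω, ‖∑ i ∈ s, Z i ω‖ ^ 2 = ∑ a, ((∑ i ∈ s, fun ω => Z i ω a) ω) ^ 2 := fun ω => by
    rw [EuclideanSpace.real_norm_sq_eq]
    simp
  simp_rw [e]
  rw [integral_finsetSum _ fun a _ => (hsum a).integrable_sq]
  simp_rw [hvar]
  rw [Finset.sum_comm]
  refine Finset.sum_congr rfl fun i _ => ?_
  rw [← integral_finsetSum _ fun a _ => (hZa i a).integrable_sq]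
  simp_rw [EuclideanSpace.real_norm_sq_eq]

end Moments

/-! ### Sample covariance of one block -/

lemma measurable_vec_outer {D : ℕ} :
    Measurable fun v : EuclideanSpace ℝ (Fin D) => vec (outer v) := by
  have : Continuous fun v : EuclideanSpace ℝ (Fin D) => vec (outer v) := by
    refine (PiLp.continuous_toLp 2 _).comp (continuous_pi fun p => ?_)
    simp only [outer, Matrix.of_apply]
    fun_prop
  exact this.measurable

lemma measurable_blockMean {n D : ℕ} (G : Finset (Fin n)) :
    Measurable fun x : Fin n → EuclideanSpace ℝ (Fin D) => blockMean x G := by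
  unfold blockMean
  fun_prop

lemma measurable_vec_blockCov {n D : ℕ} (G : Finset (Fin n)) :
    Measurable fun x : Fin n → EuclideanSpace ℝ (Fin D) => vec (blockCov x G) := by
  simp only [blockCov, vec_smul, vec_sum]
  have h : ∀ i, Measurable fun x : Fin n → EuclideanSpace ℝ (Fin D) =>
      vec (outer (x i - blockMean x G)) := fun i =>
    measurable_vec_outer.comp ((measurable_pi_apply i).sub (measurable_blockMean G))
  fun_prop

lemma dependsOn_blockCov {n D : ℕ} (G : Finset (Fin n)) :
    DependsOn (fun x : Fin n → EuclideanSpace ℝ (Fin D) => blockCov x G) (G : Set (Fin n)) := by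
  intro x y h
  have h1 : blockMean x G = blockMean y G := by
    simp only [blockMean]
    rw [Finset.sum_congr rfl fun i hi => h i hi]
  simp only [blockCov, h1]
  rw [Finset.sum_congr rfl fun i hi => by rw [h i hi]]

/-- Centering at the empirical instead of the true mean costs a rank-one correction. -/
lemma vec_blockCov_sub {n D : ℕ} (x : Fin n → EuclideanSpace ℝ (Fin D)) {G : Finset (Fin n)}
    (hG : 0 < G.card) (c : EuclideanSpace ℝ (Fin D)) (A : Matrix (Fin D) (Fin D) ℝ) :
    vec (blockCov x G) - vec A = (G.card : ℝ)⁻¹ • ∑ i ∈ G, (vec (outer (x i - c)) - vec A)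
      - vec (outer ((G.card : ℝ)⁻¹ • ∑ i ∈ G, (x i - c))) := by
  have hG' : (G.card : ℝ) ≠ 0 := by positivity
  ext ⟨a, b⟩
  have hm : ∀ a, ∑ i ∈ G, x i a = G.card * blockMean x G a := fun a => by
    simp [blockMean, hG']
  have e : ∑ i ∈ G, (x i a - blockMean x G a) * (x i b - blockMean x G b)
      = ∑ i ∈ G, (x i a - c a) * (x i b - c b)
        - G.card * ((blockMean x G a - c a) * (blockMean x G b - c b)) := by
    have : ∀ i ∈ G, (x i a - blockMean x G a) * (x i b - blockMean x G b)
      = (x i a - c a) * (x i b - c b) - (blockMean x G a - c a) * x i b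
        - (blockMean x G b - c b) * x i a
        + (blockMean x G a * blockMean x G b - c a * c b) := fun i _ => by ring
    rw [Finset.sum_congr rfl this, Finset.sum_add_distrib, Finset.sum_sub_distrib,
      Finset.sum_sub_distrib, ← Finset.mul_sum, ← Finset.mul_sum, hm, hm, Finset.sum_const,
      nsmul_eq_mul]
    ring
  simp only [blockCov, outer, vec_smul, PiLp.sub_apply, PiLp.smul_apply, vec_apply, smul_eq_mul,
    vec_sum, WithLp.ofLp_sum, Finset.sum_apply, Matrix.of_apply, Finset.sum_sub_distrib, e, hm,
    Finset.sum_const, nsmul_eq_mul]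
  field_simp
  ring

lemma norm_sq_vec_covMatrix {Ω : Type*} [MeasurableSpace Ω] {D : ℕ} (P : Measure Ω)
    (X : Ω → EuclideanSpace ℝ (Fin D)) :
    ‖vec (covMatrix P X)‖ ^ 2 = Matrix.trace (covMatrix P X * covMatrix P X) := by
  rw [EuclideanSpace.real_norm_sq_eq, Fintype.sum_prod_type]
  simp only [Matrix.trace, Matrix.diag, Matrix.mul_apply, vec_apply]
  refine Finset.sum_congr rfl fun a _ => Finset.sum_congr rfl fun b _ => ?_
  have : covMatrix P X b a = covMatrix P X a b := by
    simp [covMatrix, outer, mul_comm]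
  rw [this, pow_two]

lemma memLp_four_of_integrable_norm_pow {Ω : Type*} [MeasurableSpace Ω] {D : ℕ} {P : Measure Ω}
    {X : Ω → EuclideanSpace ℝ (Fin D)} (hXm : AEMeasurable X P)
    (hX : Integrable (fun ω => ‖X ω‖ ^ 4) P) : MemLp X 4 P := by
  refine (integrable_norm_rpow_iff hXm.aestronglyMeasurable (by norm_num) (by norm_num)).1 ?_
  refine hX.congr (ae_of_all _ fun ω => ?_)
  have e : (4 : ENNReal).toReal = ((4 : ℕ) : ℝ) := by norm_num
  simp only [e, Real.rpow_natCast]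

section

variable {Ω : Type*} [MeasurableSpace Ω] {P : Measure Ω} [IsProbabilityMeasure P] {D : ℕ}
  {X : Ω → EuclideanSpace ℝ (Fin D)}

lemma memLp_two_vec_outer (hX : MemLp X 4 P) (c : EuclideanSpace ℝ (Fin D)) :
    MemLp (fun ω => vec (outer (X ω - c))) 2 P := by
  have h4 : MemLp (fun ω => X ω - c) 4 P := hX.sub (memLp_const c)
  have hm : AEStronglyMeasurable (fun ω => vec (outer (X ω - c))) P :=
    (measurable_vec_outer.comp_aemeasurable
      h4.aestronglyMeasurable.aemeasurable).aestronglyMeasurable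
  rw [memLp_two_iff_integrable_sq_norm hm]
  refine (h4.integrable_norm_pow (p := 4) (by norm_num)).congr (ae_of_all _ fun ω => ?_)
  simp only [norm_vec_outer]
  ring

lemma integral_vec_outer (hX : MemLp X 4 P) :
    ∫ ω, vec (outer (X ω - mean P X)) ∂P = vec (covMatrix P X) := by
  ext p
  have := (EuclideanSpace.proj p : EuclideanSpace ℝ (Fin D × Fin D) →L[ℝ] ℝ).integral_comp_comm
    ((memLp_two_vec_outer hX (mean P X)).integrable one_le_two)
  exact this.symm

/-- The variance identity `𝔼‖Z - 𝔼Z‖² = 𝔼‖Z‖² - ‖𝔼Z‖²` for `Z = (X - μ)(X - μ)ᵀ`, whose squared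
Frobenius norm is `‖X - μ‖⁴`. -/
lemma integral_norm_sq_vec_outer_sub (hX : MemLp X 4 P) :
    ∫ ω, ‖vec (outer (X ω - mean P X)) - vec (covMatrix P X)‖ ^ 2 ∂P
      = (∫ ω, ‖X ω - mean P X‖ ^ 4 ∂P) - Matrix.trace (covMatrix P X * covMatrix P X) := by
  have h2 := memLp_two_vec_outer hX (mean P X)
  have h1 := h2.integrable one_le_two
  have hi : Integrable (fun ω => ‖X ω - mean P X‖ ^ 4) P :=
    (hX.sub (memLp_const (mean P X))).integrable_norm_pow (p := 4) (by norm_num)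
  have e : ∀ ω, ‖vec (outer (X ω - mean P X)) - vec (covMatrix P X)‖ ^ 2
      = ‖X ω - mean P X‖ ^ 4
        - 2 * inner ℝ (vec (covMatrix P X)) (vec (outer (X ω - mean P X)))
        + ‖vec (covMatrix P X)‖ ^ 2 := fun ω => by
    rw [norm_sub_sq_real, norm_vec_outer, real_inner_comm]
    ring
  simp_rw [e]
  have hc : Integrable
      (fun ω => 2 * inner ℝ (vec (covMatrix P X)) (vec (outer (X ω - mean P X)))) P :=
    (h1.const_inner _).const_mul 2
  rw [integral_add (by exact hi.sub hc) (integrable_const _), integral_sub hi hc,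
    integral_const_mul, integral_inner h1,
    integral_vec_outer hX, real_inner_self_eq_norm_sq, norm_sq_vec_covMatrix]
  simp only [integral_const, probReal_univ, smul_eq_mul]
  ring

lemma integral_norm_sq_sub_mean (hX : MemLp X 4 P) :
    ∫ ω, ‖X ω - mean P X‖ ^ 2 ∂P = Matrix.trace (covMatrix P X) := by
  have h2 : MemLp (fun ω => X ω - mean P X) 2 P :=
    (hX.sub (memLp_const (mean P X))).mono_exponent (by norm_num)
  simp_rw [EuclideanSpace.real_norm_sq_eq]
  have ha : ∀ a, Integrable (fun ω => (X ω - mean P X) a ^ 2) P := fun a =>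
    ((EuclideanSpace.proj a : EuclideanSpace ℝ (Fin D) →L[ℝ] ℝ).comp_memLp' h2).integrable_sq
  rw [integral_finsetSum _ fun a _ => ha a]
  simp [Matrix.trace, covMatrix, outer, pow_two]

lemma trace_covMatrix_nonneg (hX : MemLp X 4 P) : 0 ≤ Matrix.trace (covMatrix P X) := by
  rw [← integral_norm_sq_sub_mean hX]
  positivity

/-- Eigenvalues of a covariance matrix are variances. -/
lemma IsSortedEigenbasis.eigenvalue_eq_integral (hX : MemLp X 4 P)
    {b : OrthonormalBasis (Fin D) ℝ (EuclideanSpace ℝ (Fin D))} {l : Fin D → ℝ}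
    (h : IsSortedEigenbasis (covMatrix P X) b l) (i : Fin D) :
    l i = ∫ ω, inner ℝ (b i) (X ω - mean P X) ^ 2 ∂P := by
  rw [← h.inner_eigenvector, ← inner_vec_outer, real_inner_comm, ← integral_vec_outer hX,
    ← integral_inner ((memLp_two_vec_outer hX (mean P X)).integrable one_le_two)]
  simp only [inner_vec_outer_outer]

/-- Together with the gap assumption, this rules out empty blocks. -/
lemma IsSortedEigenbasis.eigenGap_le_trace (hX : MemLp X 4 P)
    {b : OrthonormalBasis (Fin D) ℝ (EuclideanSpace ℝ (Fin D))} {l : Fin D → ℝ}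
    (h : IsSortedEigenbasis (covMatrix P X) b l) (m : ℕ) :
    eigenGap l m ≤ Matrix.trace (covMatrix P X) := by
  have h0 : ∀ i, 0 ≤ l i := fun i => by
    rw [h.eigenvalue_eq_integral hX]
    positivity
  have h1 : ∀ i, l i ≤ Matrix.trace (covMatrix P X) := fun i => by
    have h2 : MemLp (fun ω => X ω - mean P X) 2 P :=
      (hX.sub (memLp_const (mean P X))).mono_exponent (by norm_num)
    rw [h.eigenvalue_eq_integral hX, ← integral_norm_sq_sub_mean hX]
    refine integral_mono_of_nonneg (ae_of_all _ fun ω => sq_nonneg _)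
      (h2.integrable_norm_pow (p := 2) (by norm_num)) (ae_of_all _ fun ω => ?_)
    have := abs_real_inner_le_norm (b i) (X ω - mean P X)
    rw [b.norm_eq_one, one_mul] at this
    exact sq_le_sq' (abs_le.1 this).1 (abs_le.1 this).2
  have h2 : 0 ≤ eigenvalueAt l (m + 1) := by
    rw [eigenvalueAt]
    split_ifs
    exacts [h0 _, le_rfl]
  have h3 : eigenvalueAt l m ≤ Matrix.trace (covMatrix P X) := by
    rw [eigenvalueAt]
    split_ifs
    exacts [h1 _, trace_covMatrix_nonneg hX]
  rw [eigenGap]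
  linarith

/-- One block: the sample covariance matrix is, with probability at least `9 / 10`, close to the
true one. -/
lemma measureReal_lt_norm_vec_blockCov_sub_le {n : ℕ} {Y : Fin n → Ω → EuclideanSpace ℝ (Fin D)}
    (hident : ∀ i, IdentDistrib (Y i) X P P) (hind : iIndepFun Y P) (hX : MemLp X 4 P)
    {G : Finset (Fin n)} (hG : 0 < G.card) :
    P.real {ω | √(20 * (((∫ ω, ‖X ω - mean P X‖ ^ 4 ∂P)
          - Matrix.trace (covMatrix P X * covMatrix P X)) / G.card))
        + 20 * (Matrix.trace (covMatrix P X) / G.card)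
        < ‖vec (blockCov (fun i => Y i ω) G) - vec (covMatrix P X)‖} ≤ 1 / 10 := by
  set c := mean P X with hc
  set A := covMatrix P X with hA
  set N : ℝ := (G.card : ℝ) with hN
  have hN0 : 0 < N := Nat.cast_pos.2 hG
  -- Stated for a general target, since it serves both the average of matrices and the average of
  -- vectors.
  have hindep : ∀ {κ : Type} [Fintype κ] {f : EuclideanSpace ℝ (Fin D) → EuclideanSpace ℝ κ},
      Measurable f → MemLp (fun ω => f (X ω)) 2 P → ∫ ω, f (X ω) ∂P = 0 →
      Integrable (fun ω => ‖N⁻¹ • ∑ i ∈ G, f (Y i ω)‖ ^ 2) P ∧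
      ∫ ω, ‖N⁻¹ • ∑ i ∈ G, f (Y i ω)‖ ^ 2 ∂P = (∫ ω, ‖f (X ω)‖ ^ 2 ∂P) / N := by
    intro κ _ f hf hL h0
    have hid : ∀ i, IdentDistrib (fun ω => f (Y i ω)) (fun ω => f (X ω)) P P :=
      fun i => (hident i).comp hf
    have hLi : ∀ i, MemLp (fun ω => f (Y i ω)) 2 P := fun i => (hid i).memLp_iff.2 hL
    refine ⟨((memLp_finsetSum G fun i _ => hLi i).const_smul N⁻¹).integrable_norm_pow (p := 2)
      (by norm_num), ?_⟩
    have h1 := integral_norm_sq_sum_eq hLi (fun i => by rw [(hid i).integral_eq, h0])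
      (fun i j hij => (hind.indepFun hij).comp hf hf) G
    have h2 : ∀ i, ∫ ω, ‖f (Y i ω)‖ ^ 2 ∂P = ∫ ω, ‖f (X ω)‖ ^ 2 ∂P := fun i =>
      ((hid i).comp (u := fun v => ‖v‖ ^ 2) (by fun_prop)).integral_eq
    simp only [h2, Finset.sum_const, nsmul_eq_mul] at h1
    simp only [norm_smul, mul_pow, integral_const_mul, h1]
    rw [Real.norm_of_nonneg (by positivity)]
    field_simp
    rw [hN]
  have hX2 : MemLp (fun ω => X ω - c) 2 P :=
    (hX.sub (memLp_const c)).mono_exponent (by norm_num)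
  have hXi : Integrable X P := hX.integrable (by norm_num)
  have hO := memLp_two_vec_outer hX c
  obtain ⟨hi1, he1⟩ := hindep (f := fun v => vec (outer (v - c)) - vec A)
    ((measurable_vec_outer.comp (measurable_id.sub_const c)).sub_const _)
    (hO.sub (memLp_const _)) (by
      rw [integral_sub (hO.integrable one_le_two) (integrable_const _), integral_vec_outer hX]
      simp [hA])
  obtain ⟨hi2, he2⟩ := hindep (f := fun v => v - c) (measurable_id.sub_const c) hX2 (by
      rw [integral_sub hXi (integrable_const _)]
      simp [hc, mean])
  rw [integral_norm_sq_vec_outer_sub hX] at he1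
  rw [integral_norm_sq_sub_mean hX] at he2
  -- Factor 20 allots probability `1/20` to each of the two terms, `1/10` in all. The rank-one term
  -- has norm equal to a squared length, so its bound enters without a square root.
  have hm1 := measureReal_mul_integral_lt_le (c := 20) (fun ω => by positivity) hi1 (by norm_num)
    he1.le
  have hm2 := measureReal_mul_integral_lt_le (c := 20) (fun ω => by positivity) hi2 (by norm_num)
    he2.le
  refine (measureReal_mono (fun ω hω => ?_)).trans ((measureReal_union_le _ _).trans
    ((add_le_add hm1 hm2).trans (by norm_num)))
  by_contra hcon
  simp only [Set.mem_union, Set.mem_ofPred_eq, not_or, not_lt] at hcon hω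
  rw [vec_blockCov_sub _ hG c] at hω
  have h1 := norm_sub_le (N⁻¹ • ∑ i ∈ G, (vec (outer (Y i ω - c)) - vec A))
    (vec (outer (N⁻¹ • ∑ i ∈ G, (Y i ω - c))))
  rw [norm_vec_outer] at h1
  have h2 := Real.le_sqrt_of_sq_le hcon.1
  linarith [hcon.2]

end

/-! ### The constants of the error level -/

/-- The deviation of one block, scaled by the constant of the geometric median, is at most the
error level. -/
lemma blockError_le {V τ L ψ ε : ℝ} {n k N : ℕ} (hn : 0 < n) (hN : 0 < N) (hnk : n < (N + 1) * k)
    (hV : 0 ≤ V) (hτ : 0 ≤ τ) (hψ : 0.2914 < ψ) (hk : k * ψ ≤ L)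
    (hε : ε = 15.2 * √(V * L / n) + 178 * (τ * L / n)) :
    1.2964 * (√(20 * (V / N)) + 20 * (τ / N)) ≤ ε := by
  have hn' : (0 : ℝ) < n := Nat.cast_pos.2 hn
  have hN' : (0 : ℝ) < N := Nat.cast_pos.2 hN
  have hN1 : (1 : ℝ) ≤ N := Nat.one_le_cast.2 hN
  have h1 : (n : ℝ) ≤ (N + 1) * k := by exact_mod_cast hnk.le
  have hL : 0 ≤ L := le_trans (by positivity) hk
  have h2 : (n : ℝ) * 0.2914 ≤ 2 * N * L := by
    have h3 : (k : ℝ) * 0.2914 ≤ L :=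
      (mul_le_mul_of_nonneg_left hψ.le (Nat.cast_nonneg k)).trans hk
    calc (n : ℝ) * 0.2914 ≤ (N + 1) * k * 0.2914 := by gcongr
      _ = (N + 1) * (k * 0.2914) := by ring
      _ ≤ (2 * N) * L := mul_le_mul (by linarith) h3 (by positivity) (by positivity)
  -- Rounding down the block size costs the factor 2, through `N + 1 ≤ 2N`. The constants fit
  -- because `1.2964² · 40 / 0.2914 < 15.2²` and `1.2964 · 40 / 0.2914 < 178`.
  have h3 : 1 / (N : ℝ) ≤ 2 / 0.2914 * (L / n) := by
    rw [div_le_iff₀ hN', div_mul_div_comm, div_mul_eq_mul_div, le_div_iff₀ (by positivity)]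
    linarith
  have hq : 0 ≤ L / n := by positivity
  have h4 : 1.2964 * √(20 * (V / N)) ≤ 15.2 * √(V * L / n) := by
    rw [← Real.sqrt_sq (show (0 : ℝ) ≤ 1.2964 by norm_num),
      ← Real.sqrt_sq (show (0 : ℝ) ≤ 15.2 by norm_num), ← Real.sqrt_mul (by positivity),
      ← Real.sqrt_mul (by positivity)]
    refine Real.sqrt_le_sqrt ?_
    calc 1.2964 ^ 2 * (20 * (V / N)) = 1.2964 ^ 2 * 20 * V * (1 / N) := by ring
      _ ≤ 1.2964 ^ 2 * 20 * V * (2 / 0.2914 * (L / n)) := by gcongr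
      _ = 1.2964 ^ 2 * 20 * (2 / 0.2914) * (V * (L / n)) := by ring
      _ ≤ 15.2 ^ 2 * (V * (L / n)) := by gcongr; norm_num
      _ = _ := by ring
  have h5 : 1.2964 * (20 * (τ / N)) ≤ 178 * (τ * L / n) := by
    calc 1.2964 * (20 * (τ / N)) = 1.2964 * 20 * τ * (1 / N) := by ring
      _ ≤ 1.2964 * 20 * τ * (2 / 0.2914 * (L / n)) := by gcongr
      _ = 1.2964 * 20 * (2 / 0.2914) * (τ * (L / n)) := by ring
      _ ≤ 178 * (τ * (L / n)) := by gcongr; norm_num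
      _ = _ := by ring
  rw [hε]
  linarith

end RobustPCA

/-! ### Assembly -/

open RobustPCA in
theorem corollary4p4 {Ω : Type*} [MeasurableSpace Ω] (P : Measure Ω) [IsProbabilityMeasure P]
    {n D : ℕ} (hn : 0 < n)
    -- the i.i.d. sample `Y 0, …, Y (n - 1)` of copies of `X`, and the fourth moment
    (X : Ω → EuclideanSpace ℝ (Fin D)) (Y : Fin n → Ω → EuclideanSpace ℝ (Fin D))
    (hY_ident : ∀ i, IdentDistrib (Y i) X P P) (hY_indep : iIndepFun Y P)
    (hX : Integrable (fun ω => ‖X ω‖ ^ 4) P)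
    -- the confidence parameter
    (δ : ℝ) (hδ0 : 0 < δ) (hδ1 : δ < 1)
    -- the disjoint groups of size `⌊n / k⌋`
    (G : Fin (RobustPCA.numBlocks δ) → Finset (Fin n))
    (hG_disj : ∀ j j', j ≠ j' → Disjoint (G j) (G j'))
    (hG_card : ∀ j, (G j).card = n / RobustPCA.numBlocks δ)
    -- the eigenvalues `l` of the covariance matrix, in decreasing order, with eigenvectors `b`
    (b : OrthonormalBasis (Fin D) ℝ (EuclideanSpace ℝ (Fin D))) (l : Fin D → ℝ)
    (hb : RobustPCA.IsSortedEigenbasis (RobustPCA.covMatrix P X) b l)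
    -- the estimator: any geometric median of the sample covariances of the groups
    (S : Ω → Matrix (Fin D) (Fin D) ℝ)
    (hS : ∀ ω, RobustPCA.IsGeometricMedian RobustPCA.frobNorm
      (fun j => RobustPCA.blockCov (fun i => Y i ω) (G j)) (S ω))
    -- its eigenvalues, in decreasing order, with eigenvectors
    (bS : Ω → OrthonormalBasis (Fin D) ℝ (EuclideanSpace ℝ (Fin D))) (lS : Ω → Fin D → ℝ)
    (hbS : ∀ ω, RobustPCA.IsSortedEigenbasis (S ω) (bS ω) (lS ω))
    -- the number of principal components, and the spectral gap condition
    (m : ℕ) (hm1 : 1 ≤ m) (hmD : m ≤ D)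
    (hgap : 4 * RobustPCA.errorLevel P X n δ < RobustPCA.eigenGap l m) :
    P {ω | 2 * RobustPCA.errorLevel P X n δ / RobustPCA.eigenGap l m
        ≤ RobustPCA.frobNorm (RobustPCA.topProj (bS ω) m - RobustPCA.topProj b m)}
      ≤ ENNReal.ofReal δ := by

  classical
  have hXm : AEMeasurable X P := (hY_ident ⟨0, hn⟩).aemeasurable_snd
  have hX4 : MemLp X 4 P := memLp_four_of_integrable_norm_pow hXm hX
  have hY : ∀ i, AEMeasurable (Y i) P := fun i => (hY_ident i).aemeasurable_fst
  set ε := errorLevel P X n δ with hε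
  set V := (∫ ω, ‖X ω - mean P X‖ ^ 4 ∂P) - Matrix.trace (covMatrix P X * covMatrix P X) with hV
  set τ := Matrix.trace (covMatrix P X) with hτ
  set L := Real.log (1.4 / δ) with hL
  have hε' : ε = 15.2 * √(V * L / n) + 178 * (τ * L / n) := rfl
  have hn' : (0 : ℝ) < n := Nat.cast_pos.2 hn
  have hkpos : 0 < numBlocks δ := Nat.succ_pos _
  have hkL : numBlocks δ * psi (7 / 18) 0.1 ≤ L := numBlocks_mul_psi_le hδ0 hδ1
  have hL0 : 0 < L := lt_of_lt_of_le (mul_pos (Nat.cast_pos.2 hkpos) psi_pos) hkL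
  have hV0 : 0 ≤ V := by
    rw [hV, ← integral_norm_sq_vec_outer_sub hX4]
    positivity
  have hτ0 : 0 ≤ τ := trace_covMatrix_nonneg hX4
  have hΔτ : eigenGap l m ≤ τ := hb.eigenGap_le_trace hX4 m
  have hετ : 178 * (τ * L / n) ≤ ε := by
    rw [hε']
    have := Real.sqrt_nonneg (V * L / n)
    linarith
  have hε0 : 0 ≤ ε := le_trans (by positivity) hετ
  have hΔ0 : 0 < eigenGap l m := lt_of_le_of_lt (by positivity) hgap
  have hτpos : 0 < τ := hΔ0.trans_le hΔτ
  -- With more blocks than observations, `L ≥ 0.2914 n`, so the second term of `ε` alone exceeds `51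
  -- τ`, contradicting `4ε < Δ_m ≤ τ`.
  have hkn : numBlocks δ ≤ n := by
    by_contra! hlt
    have h1 : (n : ℝ) * 0.2914 ≤ L := by
      refine le_trans (mul_le_mul ?_ lt_psi.le (by norm_num) (Nat.cast_nonneg _)) hkL
      exact_mod_cast hlt.le
    have h2 : τ * 0.2914 ≤ τ * L / n := by
      rw [le_div_iff₀ hn']
      nlinarith
    linarith
  have hN : 0 < n / numBlocks δ := Nat.div_pos hkn hkpos
  set r := √(20 * (V / (n / numBlocks δ : ℕ))) + 20 * (τ / (n / numBlocks δ : ℕ)) with hr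
  have hr0 : 0 < r := by
    have : 0 < τ / (n / numBlocks δ : ℕ) := div_pos hτpos (Nat.cast_pos.2 hN)
    positivity
  have hrε : 1.2964 * r ≤ ε := by
    refine blockError_le hn hN ?_ hV0 hτ0 lt_psi hkL hε'
    rw [mul_comm]
    exact Nat.lt_mul_div_succ n hkpos
  have hcount := measure_card_ge_le (κ := Fin (numBlocks δ)) hY hY_indep hG_disj
    (p := fun j x => r < ‖vec (blockCov x (G j)) - vec (covMatrix P X)‖)
    (fun j => measurableSet_lt measurable_const
      ((measurable_vec_blockCov (G j)).sub_const _).norm)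
    (fun j x y h => by
      have := dependsOn_blockCov (D := D) (G j) h
      simp only at this
      simp only [this])
    (fun j => by
      have := measureReal_lt_norm_vec_blockCov_sub_le hY_ident hY_indep hX4 (G := G j)
        (by rw [hG_card]; exact hN)
      rw [hG_card] at this
      exact this)
  rw [Fintype.card_fin] at hcount
  rw [← ofReal_measureReal]
  -- Inclusion in an event about the blocks suffices, so no measurable choice of median or
  -- eigenvectors is required.
  refine ENNReal.ofReal_le_ofReal (le_trans (measureReal_mono fun ω hω => ?_)
    (hcount.trans (exp_neg_numBlocks_mul_psi_le hδ0)))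
  rw [Set.mem_ofPred_eq, div_le_iff₀' hΔ0] at hω
  have hdk := hb.gap_mul_frobNorm_le (hbS ω) hm1 hmD
  rw [frobNorm_eq_norm_vec (S ω - _), vec_sub] at hdk
  -- `1.2964` is `11/√72` rounded up, as the robustness of the median requires.
  have hfar : 1.2964 * r ≤ ‖vec (S ω) - vec (covMatrix P X)‖ := by linarith
  have hmed : IsGeometricMedian (fun v => ‖v‖)
      (fun j => vec (blockCov (fun i => Y i ω) (G j))) (vec (S ω)) := fun z => by
    have := hS ω (Matrix.of fun a b => z (a, b))
    simp only [frobNorm_eq_norm_vec, vec_sub] at this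
    exact this
  have := hmed.card_le_card_filter hr0 (z := vec (covMatrix P X)) (by
    have := pow_le_pow_left₀ (by positivity) hfar 2
    nlinarith [sq_nonneg r])
  rw [Fintype.card_fin] at this
  exact this
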